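/- For an ideal $\mathcal I$ of subsets of a countably infinite set $D$ that contains all finite sets, call a nonempty tree $T\subseteq D^{<\omega}$ (a set of finite sequences closed under initial segments) an *$\mathcal I$-Miller tree* if every $\sigma\in T$ has an extension $\tau\in T$ with $\mathrm{succ}_T(\tau)=\{d\in D:\tau^\frown d\in T\}\notin\mathcal I$, and an *$\mathcal I$-Laver tree* if it has a stem (a shortest node with more than one immediate successor) and $\mathrm{succ}_T(\sigma)\notin\mathcal I$ for every $\sigma\in T$ extending the stem. Let $[T]$ be the set of $x\in D^\omega$ all of whose finite initial segments lie in $T$. Let $m^0(\mathcal I)$ (respectively $\ell^0(\mathcal I)$) be the family of all $X\subseteq D^\omega$ such that every $\mathcal I$-Miller (respectively $\mathcal I$-Laver) tree $T$ contains an $\mathcal I$-Miller (respectively $\mathcal I$-Laver) tree $S\subseteq T$ with $[S]\cap X=\emptyset$, and let $m^0_{\mathcal B}(\mathcal I)$, $\ell^0_{\mathcal B}(\mathcal I)$ be the $\sigma$-ideals on $D^\omega$ generated by the Borel members of $m^0(\mathcal I)$, $\ell^0(\mathcal I)$ (with the product topology on $D^\omega$, $D$ discrete). For a $\sigma$-ideal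 $\mathcal J$ let $\mathrm{add}(\mathcal J)=\min\{|\mathcal F|:\mathcal F\subseteq\mathcal J,\ \bigcup\mathcal F\notin\mathcal J\}$. Then (in ZFC) $$\mathrm{add}(m^0_{\mathcal B}(\mathcal I))=\mathrm{add}(\ell^0_{\mathcal B}(\mathcal I))=\omega_1$$ for each of the following ideals $\mathcal I$: - $\mathcal{ED}$, the ideal on $\omega\times\omega$ of all $A$ such that for some $N$, for all $n>N$, the set $\{m:(n,m)\in A\}$ has at most $N$ elements; - $\mathcal{ED}_{fin}$, the ideal on $\{(a,b)\in\omega\times\omega:b\le a\}$ defined by the same condition; - $\mathcal S$, the Solecki ideal: the ideal on $\Omega=\{C\subseteq 2^\omega \text{ clopen}:\lambda(C)=1/2\}$, with $\lambda$ the fair coin-tossing measure, generated by the sets $\{C\in\Omega:C\cap F\neq\emptyset\}$ for finite $F\subseteq 2^\omega$; - $conv$, the ideal on $\mathbb Q\cap[0,1]$ generated by the sequences in $\mathbb Q\cap[0,1]$ that converge in $\mathbb R$; - $\mathcal R$, the random graph ideal: the ideal on the vertex set of an arbitrary instance of the countable random graph generated by its cliques and anticliques. -/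

import Mathlib

open Set Filter Topology Cardinal

namespace TreeIdeals

/-! ### Trees of finite sequences and their branches -/

/-- The set of immediate successors of `σ` in the tree `T`. -/
def succSet {D : Type} (T : Descriptive.tree D) (σ : List D) : Set D :=
  {d | σ ++ [d] ∈ T}

/-- The initial segment `x|n` of an infinite sequence, as a finite sequence. -/
def initSeg {D : Type} (x : ℕ → D) (n : ℕ) : List D :=
  List.ofFn fun i : Fin n => x i

/-- The set `[T]` of branches of `T`. -/
def body {D : Type} (T : Descriptive.tree D) : Set (ℕ → D) :=
  {x | ∀ n, initSeg x n ∈ T}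

/-- `σ` is a splitting node of `T`: it belongs to `T` and has more than one immediate successor. -/
def IsSplitNode {D : Type} (T : Descriptive.tree D) (σ : List D) : Prop :=
  σ ∈ T ∧ (succSet T σ).Nontrivial

/-- `σ` is the stem of `T`, that is, the shortest splitting node. -/
def IsStem {D : Type} (T : Descriptive.tree D) (σ : List D) : Prop :=
  IsSplitNode T σ ∧ ∀ τ, IsSplitNode T τ → σ.length ≤ τ.length

/-- The (nonempty) `I`-Miller trees: every node has an extension in the tree whose set of
immediate successors is `I`-positive. -/
def millerTrees {D : Type} (I : Order.Ideal (Set D)) : Set (Descriptive.tree D) :=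
  {T | T ≠ ⊥ ∧ ∀ σ ∈ T, ∃ τ ∈ T, σ <+: τ ∧ succSet T τ ∉ I}

/-- The `I`-Laver trees: there is a stem, and every node that extends the stem has an
`I`-positive set of immediate successors. -/
def laverTrees {D : Type} (I : Order.Ideal (Set D)) : Set (Descriptive.tree D) :=
  {T | ∃ s, IsStem T s ∧ ∀ σ ∈ T, s <+: σ → succSet T σ ∉ I}

/-! ### The tree ideal and its Borel part -/

/-- The tree ideal `t⁰` of a family `𝕋` of trees. -/
def treeIdeal {D : Type} (𝕋 : Set (Descriptive.tree D)) : Set (Set (ℕ → D)) :=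
  {X | ∀ T ∈ 𝕋, ∃ S ∈ 𝕋, S ≤ T ∧ body S ∩ X = ∅}

/-- `A` is a Borel subset of `D^ω`, the product topology being taken over discrete `D`
(whatever topology `D` may carry otherwise). -/
def IsBorel {D : Type} (A : Set (ℕ → D)) : Prop :=
  @MeasurableSet _ (@borel (ℕ → D) (@Pi.topologicalSpace ℕ (fun _ => D) (fun _ => ⊥))) A

/-- The `σ`-ideal of subsets of `X` generated by the family `𝒢`. -/
def sigmaIdealGen {X : Type} (𝒢 : Set (Set X)) : Set (Set X) :=
  {A | ∃ 𝒞 : Set (Set X), 𝒞 ⊆ 𝒢 ∧ 𝒞.Countable ∧ A ⊆ ⋃₀ 𝒞}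

/-- The Borel part of the tree ideal of `𝕋`: the `σ`-ideal generated by its Borel members. -/
def borelPart {D : Type} (𝕋 : Set (Descriptive.tree D)) : Set (Set (ℕ → D)) :=
  sigmaIdealGen {A | A ∈ treeIdeal 𝕋 ∧ IsBorel A}

/-- The additivity of a family `𝒥` of sets: the least cardinality of a subfamily whose union
is not in `𝒥`. (It is `0` if there is no such subfamily.) -/
noncomputable def add {X : Type} (𝒥 : Set (Set X)) : Cardinal :=
  sInf {κ | ∃ ℱ : Set (Set X), ℱ ⊆ 𝒥 ∧ ⋃₀ ℱ ∉ 𝒥 ∧ #ℱ = κ}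

/-! ### Ideals on countable sets -/

/-- The ideal of subsets of `D` generated by the family `𝒢`. -/
def idealGen {D : Type} (𝒢 : Set (Set D)) : Order.Ideal (Set D) where
  carrier := {A | ∃ ℱ : Set (Set D), ℱ ⊆ 𝒢 ∧ ℱ.Finite ∧ A ⊆ ⋃₀ ℱ}
  lower' := fun _ _ hBA ⟨ℱ, h, hf, hA⟩ => ⟨ℱ, h, hf, hBA.trans hA⟩
  nonempty' := ⟨∅, ∅, empty_subset _, finite_empty, empty_subset _⟩
  directed' := by
    rintro A ⟨ℱ, hℱ, hf, hA⟩ B ⟨ℱ', hℱ', hf', hB⟩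
    refine ⟨A ∪ B, ⟨ℱ ∪ ℱ', union_subset hℱ hℱ', hf.union hf', ?_⟩,
      subset_union_left, subset_union_right⟩
    rw [sUnion_union]
    exact union_subset_union hA hB

/-- The ideal `ED` on `ω × ω`: the sets `A` such that, for some `N`, all vertical sections
of `A` above `n > N` have at most `N` elements. -/
def idealED : Order.Ideal (Set (ℕ × ℕ)) where
  carrier := {A | ∃ N : ℕ, ∀ n > N, {m | (n, m) ∈ A}.encard ≤ N}
  lower' := fun _ _ hBA ⟨N, hN⟩ =>
    ⟨N, fun n hn => (encard_le_encard (preimage_mono (f := Prod.mk n) hBA)).trans (hN n hn)⟩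
  nonempty' := ⟨∅, 0, fun n _ => by simp⟩
  directed' := by
    rintro A ⟨N, hN⟩ B ⟨M, hM⟩
    refine ⟨A ∪ B, ⟨N + M, fun n hn => ?_⟩, subset_union_left, subset_union_right⟩
    calc {m | (n, m) ∈ A ∪ B}.encard
        ≤ {m | (n, m) ∈ A}.encard + {m | (n, m) ∈ B}.encard := encard_union_le _ _
      _ ≤ (N : ℕ∞) + M := add_le_add (hN n (by omega)) (hM n (by omega))
      _ = ((N + M : ℕ) : ℕ∞) := by push_cast; rfl

/-- The set `{(a, b) : b ≤ a}` below the diagonal of `ω × ω`. -/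
abbrev BelowDiag : Type := {p : ℕ × ℕ // p.2 ≤ p.1}

/-- The ideal `ED_fin`: the restriction of `ED` to subsets of `{(a, b) : b ≤ a}`. -/
def idealEDfin : Order.Ideal (Set BelowDiag) where
  carrier := {A | Subtype.val '' A ∈ idealED}
  lower' := fun _ _ hBA hA => idealED.lower (image_mono hBA) hA
  nonempty' := ⟨∅, by
    change Subtype.val '' (∅ : Set BelowDiag) ∈ idealED
    rw [image_empty]
    exact Order.Ideal.bot_mem idealED⟩
  directed' := by
    intro A hA B hB
    refine ⟨A ∪ B, ?_, subset_union_left, subset_union_right⟩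
    change Subtype.val '' (A ∪ B) ∈ idealED
    rw [image_union]
    exact Order.Ideal.sup_mem hA hB

/-- The fair coin-tossing (product) probability measure on the Cantor space. -/
noncomputable def cantorMeasure : MeasureTheory.Measure (ℕ → Bool) :=
  MeasureTheory.Measure.infinitePi fun _ : ℕ => (PMF.uniformOfFintype Bool).toMeasure

/-- The set `Ω` of clopen subsets of the Cantor space of measure `1/2`. -/
abbrev HalfClopens : Type :=
  {C : TopologicalSpace.Clopens (ℕ → Bool) // cantorMeasure (C : Set (ℕ → Bool)) = 1 / 2}

/-- The Solecki ideal, generated by the sets `{C ∈ Ω : C ∩ F ≠ ∅}`, `F` a finite subset of the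
Cantor space. -/
def idealSolecki : Order.Ideal (Set HalfClopens) :=
  idealGen {A | ∃ F : Set (ℕ → Bool), F.Finite ∧
    A = {C | ((C.1 : Set (ℕ → Bool)) ∩ F).Nonempty}}

/-- The ideal `conv` on `ℚ ∩ [0, 1]`, generated by (the ranges of) the sequences of rational
numbers in `[0, 1]` that converge in the real line. -/
def idealConv : Order.Ideal (Set (Icc (0 : ℚ) 1)) :=
  idealGen {A | ∃ (u : ℕ → Icc (0 : ℚ) 1) (l : ℝ),
    Tendsto (fun n => ((u n : ℚ) : ℝ)) atTop (𝓝 l) ∧ A = range u}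

/-- `G` is (an instance of) the countable random graph: it has the extension property. -/
def IsRandomGraph (G : SimpleGraph ℕ) : Prop :=
  ∀ A B : Finset ℕ, Disjoint A B →
    ∃ v, v ∉ A ∧ v ∉ B ∧ (∀ a ∈ A, G.Adj v a) ∧ ∀ b ∈ B, ¬ G.Adj v b

/-- The ideal on the vertices of `G` generated by the cliques and the anticliques of `G`; for the
random graph this is the random graph ideal `R`. -/
def idealGraph (G : SimpleGraph ℕ) : Order.Ideal (Set ℕ) :=
  idealGen {A | G.IsClique A ∨ G.IsIndepSet A}

end TreeIdeals

/-! Each ideal `I` in question contains a family of at least `ℵ₁` sets `A i` such that every member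
of `I` includes only countably many of them. The closed sets `K i` of sequences with all entries in
`A i` lie in both tree ideals. It is shown that countably many Borel members of the tree ideal cover
only countably many `K i`; so the union of `ℵ₁` many `K i` leaves the Borel part, while countable
unions stay in it (`add_borelPart_eq_aleph_one`).

The bound on covers rests on two dichotomies. A continuous image of the Baire space either contains
all branches of a Miller (Laver) tree, which a member of the tree ideal cannot do, or is small:
`IsMillerSmall` (`IsLaverSmall` at every node). Smallness is witnessed by functions `φ` from nodes
to `I`. If `A i` is included in none of the countably many sets that the witnesses name, a sequence
in `K i` can be built one entry at a time against all witnesses, so it escapes the cover. Hence `A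
i` is included in one of countably many members of `I`, which leaves countably many `i`.

Both dichotomies are unfolded: `exists_fusion_tree` builds the tree together with initial segments
of a preimage under the continuous map, so that every branch lies in the image.

The families: graphs of codes of `x|k` for `ED` and `ED_fin`, all `C` containing `x` for `S`,
sequences tending to `r` from below for `conv`, and branches of a copy of the binary tree inside the
random graph for `R`. -/

namespace TreeIdeals

variable {D : Type}

/-! ### Initial segments and branches -/

@[simp] theorem length_initSeg (x : ℕ → D) (n : ℕ) : (initSeg x n).length = n := by
  simp [initSeg]

@[simp] theorem initSeg_zero (x : ℕ → D) : initSeg x 0 = [] := by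
  simp [initSeg]

theorem initSeg_succ (x : ℕ → D) (n : ℕ) : initSeg x (n + 1) = initSeg x n ++ [x n] := by
  simp only [initSeg, List.ofFn_succ_last]
  rfl

theorem initSeg_prefix (x : ℕ → D) {m n : ℕ} (h : m ≤ n) : initSeg x m <+: initSeg x n := by
  induction n, h using Nat.le_induction with
  | base => exact List.prefix_rfl
  | succ n _ ih =>
    rw [initSeg_succ]
    exact ih.trans (List.prefix_append _ _)

theorem initSeg_eq_of_prefix {x : ℕ → D} {l : List D} {n : ℕ} (h : l <+: initSeg x n) :
    initSeg x l.length = l := by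
  have hl : l.length ≤ n := by simpa using h.length_le
  exact (List.prefix_of_prefix_length_le (initSeg_prefix x hl) h (by simp)).eq_of_length (by simp)

theorem initSeg_eq_iff {x y : ℕ → D} {n : ℕ} : initSeg x n = initSeg y n ↔ ∀ i < n, x i = y i := by
  simp only [initSeg, List.ofFn_inj, funext_iff]
  exact ⟨fun h i hi => h ⟨i, hi⟩, fun h i => h i i.2⟩

theorem initSeg_eq_iff_getElem {x : ℕ → D} {l : List D} :
    initSeg x l.length = l ↔ ∀ i (h : i < l.length), x i = l[i] := by
  constructor
  · intro h i hi
    have : l[i]? = (initSeg x l.length)[i]? := by rw [h]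
    simpa [initSeg, hi, eq_comm] using this
  · intro h
    apply List.ext_getElem (by simp)
    intro i h1 h2
    simp [initSeg, h i h2]

/-- A sequence that is built one entry at a time, inside a given set of nodes. -/
theorem exists_branch {P : Set (List D)} {s : List D} (hs : s ∈ P)
    (h : ∀ t ∈ P, s <+: t → ∃ d, t ++ [d] ∈ P) :
    ∃ x : ℕ → D, ∀ n, s.length ≤ n → s <+: initSeg x n ∧ initSeg x n ∈ P := by
  have : Nonempty D := ⟨(h s hs List.prefix_rfl).choose⟩
  choose! e he using h
  let g : ℕ → List D := fun n => Nat.rec s (fun _ t => t ++ [e t]) n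
  have hg : ∀ n, g (n + 1) = g n ++ [e (g n)] := fun n => rfl
  have hP : ∀ n, s <+: g n ∧ g n ∈ P := by
    intro n
    induction n with
    | zero => exact ⟨List.prefix_rfl, hs⟩
    | succ n ih =>
      rw [hg]
      exact ⟨ih.1.trans (List.prefix_append _ _), he _ ih.2 ih.1⟩
  have hlen : ∀ n, (g n).length = s.length + n := by
    intro n
    induction n with
    | zero => rfl
    | succ n ih => rw [hg]; simp [ih]; omega
  have hmono : ∀ m n, m ≤ n → g m <+: g n := by
    intro m n hmn
    induction n, hmn using Nat.le_induction with
    | base => exact List.prefix_rfl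
    | succ n _ ih => rw [hg]; exact ih.trans (List.prefix_append _ _)
  let x : ℕ → D := fun i => (g (i + 1))[i]'(by have := hlen (i + 1); omega)
  have hx : ∀ n, initSeg x (g n).length = g n := by
    intro n
    rw [initSeg_eq_iff_getElem]
    intro i hi
    rcases le_total (i + 1) n with h | h
    · exact (hmono _ _ h).getElem _
    · exact ((hmono _ _ h).getElem hi).symm
  refine ⟨x, fun n hn => ?_⟩
  have := hx (n - s.length)
  rw [hlen, Nat.add_sub_cancel' hn] at this
  rw [this]
  exact hP _

theorem mem_body_iff_of_le {T : Descriptive.tree D} {x : ℕ → D} (N : ℕ)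
    (h : ∀ n, N ≤ n → initSeg x n ∈ T) : x ∈ body T := by
  intro n
  exact Descriptive.Tree.mem_of_prefix (initSeg_prefix x (le_max_left n N))
    (h _ (le_max_right n N))

theorem body_mono {S T : Descriptive.tree D} (h : S ≤ T) : body S ⊆ body T :=
  fun _ hx n => h (hx n)

/-! ### Continuous images of the Baire space -/

/-- The growing `u n` determine a point `z` of the Baire space. The witnesses `y` converge to `z`
and their images to `x`, so `f z = x` by continuity. -/
theorem mem_range_of_cylinders [TopologicalSpace D] [DiscreteTopology D]
    {f : (ℕ → ℕ) → ℕ → D} (hf : Continuous f) {u : ℕ → List ℕ} (hu : ∀ n, u n <+: u (n + 1))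
    {x : ℕ → D} (h : ∀ k, ∃ n, k ≤ (u n).length ∧
      ∃ y, initSeg y (u n).length = u n ∧ initSeg (f y) k = initSeg x k) :
    x ∈ range f := by
  choose n hn y hy hfy using h
  have hmono : ∀ a b, a ≤ b → u a <+: u b := by
    intro a b hab
    induction b, hab using Nat.le_induction with
    | base => exact List.prefix_rfl
    | succ b _ ih => exact ih.trans (hu b)
  let z : ℕ → ℕ := fun i => (u (n (i + 1)))[i]'(hn (i + 1))
  have hz : ∀ k, initSeg z (u (n k)).length = u (n k) := by
    intro k
    rw [initSeg_eq_iff_getElem]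
    intro i hi
    rcases le_total (n (i + 1)) (n k) with h | h
    · exact (hmono _ _ h).getElem _
    · exact ((hmono _ _ h).getElem hi).symm
  have hyz : Tendsto y atTop (𝓝 z) := by
    rw [tendsto_pi_nhds]
    intro i
    apply tendsto_const_nhds.congr'
    filter_upwards [eventually_gt_atTop i] with k hk
    exact initSeg_eq_iff.1 ((hz k).trans (hy k).symm) i (hk.trans_le (hn k))
  have hfx : Tendsto (fun k => f (y k)) atTop (𝓝 x) := by
    rw [tendsto_pi_nhds]
    intro i
    apply tendsto_const_nhds.congr'
    filter_upwards [eventually_gt_atTop i] with k hk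
    exact (initSeg_eq_iff.1 (hfy k) i hk).symm
  exact ⟨z, tendsto_nhds_unique ((hf.tendsto z).comp hyz) hfx⟩

/-! ### Fusion -/

/-- Positively many immediate successors of `t` stay in `N` together with some immediate
successor of `u`. -/
def IsLeaf (I : Order.Ideal (Set D)) (N : List D → List ℕ → Prop) (u : List ℕ)
    (t : List D) : Prop :=
  {d | ∃ j, N (t ++ [d]) (u ++ [j])} ∉ I

/-- `F` branches according to `P` except at leaves, and each of its branches passes through
a leaf. -/
def IsFront (I : Order.Ideal (Set D)) (P : Set D → Prop) (N : List D → List ℕ → Prop)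
    (u : List ℕ) (F : Set (List D)) : Prop :=
  (∀ t ∈ F, IsLeaf I N u t ∨ P {d | t ++ [d] ∈ F}) ∧
    ∀ (x : ℕ → D) (m : ℕ), (∀ n ≥ m, initSeg x n ∈ F) → ∃ n ≥ m, IsLeaf I N u (initSeg x n)

/-- `N t u` is to be read as: the part of the image coming from `u` is large at `t`. A node carries
its current `u` and a front. The tree follows the front until a leaf; there it takes the positively
many successors that allow `u` to grow by one entry, and starts a new front at each. Branches of
fronts reach leaves, so `u` grows infinitely often along every branch. -/
theorem exists_fusion_tree {I : Order.Ideal (Set D)} {P : Set D → Prop}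
    (hP : ∀ A, A ∉ I → P A) {N : List D → List ℕ → Prop}
    (hN : ∀ t u, N t u → ∃ F, t ∈ F ∧ IsFront I P N u F) {s : List D} (hs : N s []) :
    ∃ T : Descriptive.tree D, s ∈ T ∧ (∀ σ ∈ T, σ <+: s ∨ s <+: σ) ∧
      (∀ σ ∈ T, s <+: σ → P (succSet T σ)) ∧
      ∀ x ∈ body T, (∀ n, ∃ m ≥ n, succSet T (initSeg x m) ∉ I) ∧
        ∃ u : ℕ → List ℕ, (∀ n, u n <+: u (n + 1)) ∧
          ∀ k, ∃ n, k ≤ (u n).length ∧ ∃ m ≥ k, N (initSeg x m) (u n) := by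
  classical
  choose! F hFmem hF using hN
  -- The new entry is fixed as a function of `u` and `t`, with a dummy value `0`, so that the state
  -- is determined by the node.
  have hj : ∀ (u : List ℕ) (t : List D), ∃ j, (∃ j, N t (u ++ [j])) → N t (u ++ [j]) := by
    intro u t
    by_cases h : ∃ j, N t (u ++ [j])
    · exact ⟨h.choose, fun _ => h.choose_spec⟩
    · exact ⟨0, fun h' => absurd h' h⟩
  choose j hj using hj
  let Q : Type := List D × List ℕ × Set (List D)
  let allowed : Q → Set D := fun q =>
    if IsLeaf I N q.2.1 q.1 then {d | ∃ j, N (q.1 ++ [d]) (q.2.1 ++ [j])}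
    else {d | q.1 ++ [d] ∈ q.2.2}
  let next : Q → D → Q := fun q d =>
    if IsLeaf I N q.2.1 q.1 then
      (q.1 ++ [d], q.2.1 ++ [j q.2.1 (q.1 ++ [d])], F (q.1 ++ [d]) (q.2.1 ++ [j q.2.1 (q.1 ++ [d])]))
    else (q.1 ++ [d], q.2)
  let state : List D → Q := fun l => (l.drop s.length).foldl next (s, [], F s [])
  have state_s : state s = (s, [], F s []) := by simp [state]
  have state_succ : ∀ l d, s <+: l → state (l ++ [d]) = next (state l) d := by
    rintro _ d ⟨r, rfl⟩
    simp [state]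
  let T : Descriptive.tree D :=
    ⟨{τ | τ <+: s ∨ (s <+: τ ∧ ∀ l d, s <+: l → l ++ [d] <+: τ → d ∈ allowed (state l))}, by
      rintro τ a (h | ⟨h, h'⟩)
      · exact Or.inl ((List.prefix_append _ _).trans h)
      · rcases List.prefix_concat_iff.1 h with h | h
        · exact Or.inl (h ▸ List.prefix_append _ _)
        · exact Or.inr ⟨h, fun l d hl hd => h' l d hl (hd.trans (List.prefix_append _ _))⟩⟩
  have memT : ∀ τ, s <+: τ →
      (τ ∈ T ↔ ∀ l d, s <+: l → l ++ [d] <+: τ → d ∈ allowed (state l)) := by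
    intro τ hτ
    refine ⟨?_, fun h => Or.inr ⟨hτ, h⟩⟩
    rintro (h | h)
    · intro l d hl hd
      have h1 := hl.length_le
      have h2 := (hd.trans h).length_le
      simp at h2
      omega
    · exact h.2
  have succT : ∀ τ ∈ T, s <+: τ → succSet T τ = allowed (state τ) := by
    intro τ hτT hτ
    have hτ' : ∀ d, s <+: τ ++ [d] := fun d => hτ.trans (List.prefix_append _ _)
    ext d
    change τ ++ [d] ∈ T ↔ _
    rw [memT _ (hτ' d)]
    refine ⟨fun h => h τ d hτ List.prefix_rfl, fun h l e hl he => ?_⟩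
    rcases List.prefix_concat_iff.1 he with he | he
    · obtain ⟨rfl, he⟩ := List.append_inj' he rfl
      simp at he
      exact he ▸ h
    · exact (memT _ hτ).1 hτT l e hl he
  have inv : ∀ τ ∈ T, s <+: τ → (state τ).1 = τ ∧ τ ∈ (state τ).2.2 ∧
      IsFront I P N (state τ).2.1 (state τ).2.2 := by
    rintro _ hT ⟨r, rfl⟩
    induction r using List.reverseRecOn with
    | nil => simpa [state_s] using ⟨hFmem _ _ hs, hF _ _ hs⟩
    | append_singleton r d ih =>
      rw [← List.append_assoc] at hT ⊢
      have hT' := Descriptive.Tree.mem_of_append hT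
      have hpre := List.prefix_append s r
      obtain ⟨h1, h2, h3⟩ := ih hT'
      have hd : d ∈ allowed (state (s ++ r)) := by rw [← succT _ hT' hpre]; exact hT
      rw [state_succ _ _ hpre]
      generalize state (s ++ r) = q at *
      simp only [next, allowed] at hd ⊢
      split_ifs at hd ⊢ with hleaf
      · have := hj _ _ hd
        rw [h1] at this ⊢
        exact ⟨rfl, hFmem _ _ this, hF _ _ this⟩
      · rw [← h1]
        exact ⟨rfl, hd, h3⟩
  refine ⟨T, Or.inl List.prefix_rfl, fun σ hσ => hσ.imp id And.left, ?_, ?_⟩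
  · intro σ hσ hsσ
    rw [succT σ hσ hsσ]
    obtain ⟨h1, h2, h3⟩ := inv σ hσ hsσ
    simp only [allowed]
    split_ifs with h
    · exact hP _ h
    · rw [h1] at h ⊢
      exact (h3.1 _ h2).resolve_left h
  intro x hx
  have hsx : ∀ n ≥ s.length, s <+: initSeg x n := by
    intro n hn
    rcases hx n with h | h
    · rw [h.eq_of_length_le (by simpa using hn)]
    · exact h.1
  let q : ℕ → Q := fun n => state (initSeg x n)
  have hq : ∀ n ≥ s.length, q (n + 1) = next (q n) (x n) := by
    intro n hn
    simp only [q, initSeg_succ]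
    exact state_succ _ _ (hsx n hn)
  have hallowed : ∀ n ≥ s.length, x n ∈ allowed (q n) := by
    intro n hn
    rw [← succT _ (hx n) (hsx n hn)]
    change _ ∈ T
    rw [← initSeg_succ]
    exact hx _
  have hinv : ∀ n ≥ s.length, (q n).1 = initSeg x n ∧ initSeg x n ∈ (q n).2.2 ∧
      IsFront I P N (q n).2.1 (q n).2.2 := fun n hn => inv _ (hx n) (hsx n hn)
  have hinf : ∀ n ≥ s.length, ∃ m ≥ n, IsLeaf I N (q m).2.1 (initSeg x m) := by
    intro n hn
    -- Without further leaves the front would never change, and the branch would stay in it without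
    -- meeting a leaf.
    by_contra! hno
    have hconst : ∀ m ≥ n, (q m).2 = (q n).2 := by
      intro m hm
      induction m, hm using Nat.le_induction with
      | base => rfl
      | succ m hm ih =>
        have := hno m hm
        rw [hq m (hn.le.trans hm)]
        simp only [next, (hinv m (hn.le.trans hm)).1]
        rw [if_neg this, ih]
    obtain ⟨m, hm, hleaf⟩ := (hinv n hn).2.2.2 x n fun m hm => by
      have := (hinv m (hn.le.trans hm)).2.1
      rwa [hconst m hm] at this
    rw [← hconst m hm] at hleaf
    exact hno m hm hleaf
  have hcommit : ∀ n ≥ s.length, IsLeaf I N (q n).2.1 (initSeg x n) →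
      N (initSeg x (n + 1)) (q (n + 1)).2.1 ∧
        (q (n + 1)).2.1.length = (q n).2.1.length + 1 := by
    intro n hn hleaf
    have h := hallowed n hn
    rw [hq n hn]
    simp only [allowed, next, (hinv n hn).1] at h ⊢
    rw [if_pos hleaf] at h ⊢
    rw [← initSeg_succ]
    have h' := hj _ _ h
    rw [← initSeg_succ] at h'
    exact ⟨h', by simp⟩
  have hstep : ∀ n ≥ s.length, (q n).2.1 <+: (q (n + 1)).2.1 := by
    intro n hn
    rw [hq n hn]
    simp only [next]
    split_ifs
    · exact List.prefix_append _ _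
    · exact List.prefix_rfl
  constructor
  · intro n
    obtain ⟨m, hm, hleaf⟩ := hinf (max n s.length) (le_max_right _ _)
    have hms : s.length ≤ m := (le_max_right _ _).trans hm
    refine ⟨m, (le_max_left _ _).trans hm, ?_⟩
    rw [succT _ (hx m) (hsx m hms)]
    simp only [allowed]
    have h1 := (hinv m hms).1
    simp only [q] at h1 hleaf
    rw [h1, if_pos hleaf]
    exact hleaf
  · refine ⟨fun n => (q (s.length + n)).2.1, fun n => hstep _ (by omega), fun k => ?_⟩
    have hmono : ∀ a ≥ s.length, ∀ b ≥ a, (q a).2.1.length ≤ (q b).2.1.length := by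
      intro a ha b hb
      induction b, hb using Nat.le_induction with
      | base => rfl
      | succ b hb ih => exact ih.trans (hstep b (ha.le.trans hb)).length_le
    have : ∀ k, ∃ n ≥ s.length, k ≤ (q (n + 1)).2.1.length ∧ k ≤ n + 1 ∧
        N (initSeg x (n + 1)) (q (n + 1)).2.1 := by
      intro k
      induction k with
      | zero =>
        obtain ⟨m, hm, hleaf⟩ := hinf s.length le_rfl
        exact ⟨m, hm, Nat.zero_le _, Nat.zero_le _, (hcommit m hm hleaf).1⟩
      | succ k ih =>
        obtain ⟨n, hn, h1, h2, -⟩ := ih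
        obtain ⟨m, hm, hleaf⟩ := hinf (n + 1) (by omega)
        have hms : m ≥ s.length := by omega
        have := hmono (n + 1) (by omega) m hm
        have := (hcommit m hms hleaf).2
        exact ⟨m, hms, by omega, by omega, (hcommit m hms hleaf).1⟩
    obtain ⟨n, hn, h1, h2, h3⟩ := this k
    have e : s.length + (n + 1 - s.length) = n + 1 := by omega
    refine ⟨n + 1 - s.length, ?_, n + 1, h2, ?_⟩
    · simpa only [e] using h1
    · simpa only [e] using h3


/-- A sequence that is built one entry at a time. -/
theorem exists_seq_of_initSeg {p : List D → D → Prop} (h : ∀ l, ∃ d, p l d) :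
    ∃ x : ℕ → D, ∀ n, p (initSeg x n) (x n) := by
  obtain ⟨x, hx⟩ := exists_branch (P := {l | ∀ l' d, l' ++ [d] <+: l → p l' d}) (s := [])
    (by intro l' d h; simp at h) fun t ht _ => by
      obtain ⟨d, hd⟩ := h t
      refine ⟨d, fun l' e he => ?_⟩
      rcases List.prefix_concat_iff.1 he with he | he
      · obtain ⟨rfl, he⟩ := List.append_inj' he rfl
        simp at he
        exact he ▸ hd
      · exact ht l' e he
  refine ⟨x, fun n => (hx (n + 1) (Nat.zero_le _)).2 _ _ ?_⟩
  rw [initSeg_succ]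

/-! ### Miller and Laver trees -/

theorem body_nonempty_of_miller {I : Order.Ideal (Set D)} {T : Descriptive.tree D}
    (hT : T ∈ millerTrees I) : (body T).Nonempty := by
  obtain ⟨hne, h⟩ := hT
  have hnil : [] ∈ T := by simpa using hne
  obtain ⟨x, hx⟩ := exists_branch (P := {t | t ∈ T}) (s := []) hnil fun t ht _ => by
    obtain ⟨τ, hτ, hpre, hpos⟩ := h t ht
    obtain ⟨d, hd⟩ : (succSet T τ).Nonempty := by
      rw [nonempty_iff_ne_empty]
      intro he
      exact hpos (he ▸ Order.Ideal.bot_mem I)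
    obtain ⟨r, rfl⟩ := hpre
    have hd : t ++ r ++ [d] ∈ T := hd
    rcases r with _ | ⟨e, r⟩
    · exact ⟨d, by simpa using hd⟩
    · refine ⟨e, Descriptive.Tree.mem_of_append (y := r ++ [d]) ?_⟩
      simpa using hd
  exact ⟨x, fun n => (hx n (Nat.zero_le _)).2⟩

theorem body_nonempty_of_laver {I : Order.Ideal (Set D)} {T : Descriptive.tree D}
    (hT : T ∈ laverTrees I) : (body T).Nonempty := by
  obtain ⟨s, hs, h⟩ := hT
  obtain ⟨x, hx⟩ := exists_branch (P := {t | t ∈ T}) (s := s) hs.1.1 fun t ht hst => by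
    obtain ⟨d, hd⟩ : (succSet T t).Nonempty := by
      rw [nonempty_iff_ne_empty]
      intro he
      exact h t ht hst (he ▸ Order.Ideal.bot_mem I)
    exact ⟨d, hd⟩
  exact ⟨x, mem_body_iff_of_le s.length fun n hn => (hx n hn).2⟩

theorem not_body_subset_of_mem_treeIdeal {𝕋 : Set (Descriptive.tree D)}
    (h𝕋 : ∀ T ∈ 𝕋, (body T).Nonempty) {X : Set (ℕ → D)} (hX : X ∈ treeIdeal 𝕋)
    {T : Descriptive.tree D} (hT : T ∈ 𝕋) : ¬ body T ⊆ X := by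
  intro h
  obtain ⟨S, hS, hST, he⟩ := hX T hT
  obtain ⟨x, hx⟩ := h𝕋 S hS
  exact (he ▸ (⟨hx, h (body_mono hST hx)⟩ : x ∈ body S ∩ X) : x ∈ (∅ : Set (ℕ → D)))

theorem nontrivial_of_notMem {I : Order.Ideal (Set D)} (hI : ∀ d, {d} ∈ I) {A : Set D}
    (hA : A ∉ I) : A.Nontrivial := by
  rw [← not_subsingleton_iff]
  intro h
  rcases h.eq_empty_or_singleton with rfl | ⟨d, rfl⟩
  · exact hA (Order.Ideal.bot_mem I)
  · exact hA (hI d)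

/-- A node shorter than `s` cannot split: its immediate successors in `T` are all initial segments
of `s`, of the same length. -/
theorem mem_laverTrees_of_stem {I : Order.Ideal (Set D)} (hI : ∀ d, {d} ∈ I)
    {T : Descriptive.tree D} {s : List D} (hs : s ∈ T) (hcomp : ∀ σ ∈ T, σ <+: s ∨ s <+: σ)
    (hpos : ∀ σ ∈ T, s <+: σ → succSet T σ ∉ I) : T ∈ laverTrees I := by
  refine ⟨s, ⟨⟨hs, nontrivial_of_notMem hI (hpos s hs List.prefix_rfl)⟩, ?_⟩, hpos⟩
  rintro τ ⟨-, a, ha, b, hb, hab⟩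
  by_contra! hlt
  have key : ∀ c, τ ++ [c] ∈ T → τ ++ [c] <+: s := by
    intro c hc
    refine (hcomp _ hc).elim id fun h => ?_
    rw [h.eq_of_length_le (by simp; omega)]
  have := List.prefix_of_prefix_length_le (key a ha) (key b hb) (by simp)
  simp at this
  exact hab this

/-- The subtree of all nodes that are comparable with `σ`. -/
def treeAbove (T : Descriptive.tree D) (σ : List D) : Descriptive.tree D :=
  ⟨{τ | τ ∈ T ∧ (τ <+: σ ∨ σ <+: τ)}, by
    rintro τ a ⟨h, h'⟩
    refine ⟨Descriptive.Tree.mem_of_append h, ?_⟩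
    rcases h' with h' | h'
    · exact Or.inl ((List.prefix_append _ _).trans h')
    · rcases List.prefix_concat_iff.1 h' with rfl | h'
      · exact Or.inl (List.prefix_append _ _)
      · exact Or.inr h'⟩

theorem treeAbove_le (T : Descriptive.tree D) (σ : List D) : treeAbove T σ ≤ T :=
  fun _ h => h.1

theorem succSet_treeAbove {T : Descriptive.tree D} {σ τ : List D} (h : σ <+: τ) :
    succSet (treeAbove T σ) τ = succSet T τ := by
  ext d
  exact ⟨fun h' => h'.1, fun h' => ⟨h', Or.inr (h.trans (List.prefix_append _ _))⟩⟩

theorem treeAbove_mem_millerTrees {I : Order.Ideal (Set D)} {T : Descriptive.tree D}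
    (hT : T ∈ millerTrees I) {σ : List D} (hσ : σ ∈ T) : treeAbove T σ ∈ millerTrees I := by
  have hmem : σ ∈ treeAbove T σ := ⟨hσ, Or.inl List.prefix_rfl⟩
  refine ⟨?_, ?_⟩
  · have := Descriptive.Tree.mem_of_prefix (List.nil_prefix) hmem
    simpa using this
  · intro τ hτ
    obtain ⟨ρ, hρT, hρ, hτρ⟩ : ∃ ρ ∈ T, σ <+: ρ ∧ τ <+: ρ := by
      rcases hτ.2 with h | h
      · exact ⟨σ, hσ, List.prefix_rfl, h⟩
      · exact ⟨τ, hτ.1, h, List.prefix_rfl⟩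
    obtain ⟨υ, hυ, hpre, hpos⟩ := hT.2 ρ hρT
    refine ⟨υ, ⟨hυ, Or.inr (hρ.trans hpre)⟩, hτρ.trans hpre, ?_⟩
    rwa [succSet_treeAbove (hρ.trans hpre)]

theorem body_treeAbove_inter {T : Descriptive.tree D} {σ : List D} {d : D} {A : Set D}
    (hd : d ∉ A) : body (treeAbove T (σ ++ [d])) ∩ {z | ∀ n, z n ∈ A} = ∅ := by
  rw [eq_empty_iff_forall_notMem]
  rintro x ⟨hx, hA⟩
  have h : initSeg x (σ.length + 1) = σ ++ [d] := by
    rcases (hx (σ.length + 1)).2 with h | h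
    · exact h.eq_of_length (by simp)
    · exact (h.eq_of_length (by simp)).symm
  rw [initSeg_succ] at h
  have := (List.append_inj' h rfl).2
  simp at this
  exact hd (this ▸ hA _)

theorem exists_mem_diff_of_notMem {I : Order.Ideal (Set D)} {A B : Set D} (hA : A ∈ I)
    (hB : B ∉ I) : ∃ d ∈ B, d ∉ A := by
  by_contra! h
  exact hB (I.lower h hA)

/-- A positive node has a successor `d` outside `A`; every branch of the part of the tree above that
successor has the entry `d`. -/
theorem forall_mem_mem_treeIdeal_miller {I : Order.Ideal (Set D)} {A : Set D} (hA : A ∈ I) :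
    {z : ℕ → D | ∀ n, z n ∈ A} ∈ treeIdeal (millerTrees I) := by
  intro T hT
  obtain ⟨τ, -, -, hpos⟩ := hT.2 [] (by simpa using hT.1)
  obtain ⟨d, hd, hdA⟩ := exists_mem_diff_of_notMem hA hpos
  exact ⟨_, treeAbove_mem_millerTrees hT hd, treeAbove_le _ _, body_treeAbove_inter hdA⟩

theorem forall_mem_mem_treeIdeal_laver {I : Order.Ideal (Set D)} (hI : ∀ d, {d} ∈ I)
    {A : Set D} (hA : A ∈ I) :
    {z : ℕ → D | ∀ n, z n ∈ A} ∈ treeIdeal (laverTrees I) := by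
  rintro T ⟨s, hs, hT⟩
  obtain ⟨d, hd, hdA⟩ := exists_mem_diff_of_notMem hA (hT s hs.1.1 List.prefix_rfl)
  refine ⟨treeAbove T (s ++ [d]), mem_laverTrees_of_stem hI (s := s ++ [d])
    ⟨hd, Or.inl List.prefix_rfl⟩ (fun σ hσ => hσ.2) fun σ hσ hpre => ?_,
    treeAbove_le _ _, body_treeAbove_inter hdA⟩
  rw [succSet_treeAbove hpre]
  exact hT σ hσ.1 ((List.prefix_append _ _).trans hpre)

/-! ### The dichotomies for analytic sets -/

/-- The image under `f` of the sequences that extend `u`. -/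
def cylinderImage (f : (ℕ → ℕ) → ℕ → D) (u : List ℕ) : Set (ℕ → D) :=
  f '' {y | initSeg y u.length = u}

theorem cylinderImage_nil (f : (ℕ → ℕ) → ℕ → D) : cylinderImage f [] = range f := by
  simp [cylinderImage]

theorem mem_cylinderImage_succ {f : (ℕ → ℕ) → ℕ → D} {u : List ℕ} {x : ℕ → D}
    (hx : x ∈ cylinderImage f u) : ∃ j, x ∈ cylinderImage f (u ++ [j]) := by
  obtain ⟨y, hy, rfl⟩ := hx
  refine ⟨y u.length, y, ?_, rfl⟩
  have hy : initSeg y u.length = u := hy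
  simp [initSeg_succ, hy]

theorem body_subset_range [TopologicalSpace D] [DiscreteTopology D]
    {f : (ℕ → ℕ) → ℕ → D} (hf : Continuous f) {N : List D → List ℕ → Prop}
    (hN : ∀ t u, N t u → ∃ x ∈ cylinderImage f u, initSeg x t.length = t) {x : ℕ → D}
    (hx : ∃ u : ℕ → List ℕ, (∀ n, u n <+: u (n + 1)) ∧
      ∀ k, ∃ n, k ≤ (u n).length ∧ ∃ m ≥ k, N (initSeg x m) (u n)) : x ∈ range f := by
  obtain ⟨u, hu, h⟩ := hx
  refine mem_range_of_cylinders hf hu fun k => ?_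
  obtain ⟨n, hn, m, hm, hNm⟩ := h k
  obtain ⟨_, ⟨y, hy, rfl⟩, hz⟩ := hN _ _ hNm
  rw [length_initSeg, initSeg_eq_iff] at hz
  exact ⟨n, hn, y, hy, initSeg_eq_iff.2 fun i hi => hz i (hi.trans_le hm)⟩

/-! ### The Miller dichotomy. -/

/-- `X` is covered by countably many sets of branches all of whose nodes have few successors. -/
def IsMillerSmall (I : Order.Ideal (Set D)) (X : Set (ℕ → D)) : Prop :=
  ∃ Φ : Set (List D → Set D), Φ.Countable ∧ (∀ φ ∈ Φ, ∀ l, φ l ∈ I) ∧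
    ∀ x ∈ X, ∃ φ ∈ Φ, ∀ m, x m ∈ φ (initSeg x m)

theorem IsMillerSmall.mono {I : Order.Ideal (Set D)} {X Y : Set (ℕ → D)}
    (h : IsMillerSmall I Y) (hXY : X ⊆ Y) : IsMillerSmall I X := by
  obtain ⟨Φ, h1, h2, h3⟩ := h
  exact ⟨Φ, h1, h2, fun x hx => h3 x (hXY hx)⟩

theorem IsMillerSmall.iUnion {I : Order.Ideal (Set D)} {ι : Sort*} [Countable ι]
    {X : ι → Set (ℕ → D)} (h : ∀ i, IsMillerSmall I (X i)) : IsMillerSmall I (⋃ i, X i) := by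
  choose Φ h1 h2 h3 using h
  refine ⟨⋃ i, Φ i, countable_iUnion h1, ?_, ?_⟩
  · intro φ hφ
    obtain ⟨i, hi⟩ := mem_iUnion.1 hφ
    exact h2 i φ hi
  · intro x hx
    obtain ⟨i, hi⟩ := mem_iUnion.1 hx
    obtain ⟨φ, hφ, h⟩ := h3 i x hi
    exact ⟨φ, mem_iUnion.2 ⟨i, hφ⟩, h⟩

theorem IsMillerSmall.union {I : Order.Ideal (Set D)} {X Y : Set (ℕ → D)}
    (hX : IsMillerSmall I X) (hY : IsMillerSmall I Y) : IsMillerSmall I (X ∪ Y) := by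
  rw [union_eq_iUnion]
  exact IsMillerSmall.iUnion fun b => by cases b <;> assumption

theorem isMillerSmall_empty (I : Order.Ideal (Set D)) : IsMillerSmall I ∅ :=
  ⟨∅, countable_empty, by simp, by simp⟩

/-- Otherwise a single `φ`, naming at `σ` the directions in which `X` is not small, handles the
sequences that always take such directions. All others in `X` lie in one of countably many small
pieces. -/
theorem exists_positive_of_not_isMillerSmall [Countable D] {I : Order.Ideal (Set D)}
    {X : Set (ℕ → D)} (h : ¬ IsMillerSmall I X) :
    ∃ σ : List D, {d | ¬ IsMillerSmall I
      {x ∈ X | initSeg x (σ.length + 1) = σ ++ [d]}} ∉ I := by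
  by_contra! hσ
  apply h
  have h1 : IsMillerSmall I {x | ∀ m, x m ∈ {d | ¬ IsMillerSmall I
      {z ∈ X | initSeg z ((initSeg x m).length + 1) = initSeg x m ++ [d]}}} :=
    ⟨{fun σ : List D => {d | ¬ IsMillerSmall I
        {x ∈ X | initSeg x (σ.length + 1) = σ ++ [d]}}},
      countable_singleton _, by rintro _ rfl; exact hσ, fun x hx => ⟨_, rfl, hx⟩⟩
  have h2 : IsMillerSmall I (⋃ σ : List D, ⋃ d : D, ⋃ _ : IsMillerSmall I
      {x ∈ X | initSeg x (σ.length + 1) = σ ++ [d]},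
      {x ∈ X | initSeg x (σ.length + 1) = σ ++ [d]}) :=
    IsMillerSmall.iUnion fun σ => IsMillerSmall.iUnion fun d => IsMillerSmall.iUnion id
  refine (h1.union h2).mono fun x hx => ?_
  by_contra! hno
  simp only [mem_union, not_or, mem_iUnion, not_exists] at hno
  obtain ⟨hno1, hno2⟩ := hno
  simp only [mem_ofPred_eq, not_forall, not_not] at hno1
  obtain ⟨m, hm⟩ := hno1
  exact hno2 _ _ hm ⟨hx, by rw [length_initSeg, initSeg_succ]⟩

theorem exists_miller_body_subset_range [Countable D] [TopologicalSpace D] [DiscreteTopology D]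
    {I : Order.Ideal (Set D)} (hI : ∀ d, {d} ∈ I) {f : (ℕ → ℕ) → ℕ → D} (hf : Continuous f)
    (h : ¬ IsMillerSmall I (range f)) : ∃ T ∈ millerTrees I, body T ⊆ range f := by
  let N : List D → List ℕ → Prop := fun t u =>
    ¬ IsMillerSmall I {x ∈ cylinderImage f u | initSeg x t.length = t}
  have hne : ∀ t u, N t u → ∃ x ∈ cylinderImage f u, initSeg x t.length = t := by
    intro t u htu
    by_contra! hno
    apply htu
    convert isMillerSmall_empty I
    rw [eq_empty_iff_forall_notMem]
    exact fun x hx => hno x hx.1 hx.2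
  have hsucc : ∀ t u, N t u → ∃ j, N t (u ++ [j]) := by
    intro t u htu
    by_contra! hno
    simp only [N, not_not] at hno
    refine htu ((IsMillerSmall.iUnion hno).mono ?_)
    rintro x ⟨hx, hxt⟩
    obtain ⟨j, hj⟩ := mem_cylinderImage_succ hx
    exact mem_iUnion.2 ⟨j, hj, hxt⟩
  have hfront : ∀ t u, N t u → ∃ F, t ∈ F ∧ IsFront I Set.Nonempty N u F := by
    intro t u htu
    obtain ⟨σ, hσ⟩ := exists_positive_of_not_isMillerSmall htu
    -- Two different directions at `σ` are taken by sequences through `t`, so `t` cannot go beyond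
    -- `σ` or leave it.
    have htσ : t <+: σ := by
      obtain ⟨a, ha, b, hb, hab⟩ := nontrivial_of_notMem hI hσ
      have key : ∀ c, (¬ IsMillerSmall I {x ∈ {x ∈ cylinderImage f u | initSeg x t.length = t} |
          initSeg x (σ.length + 1) = σ ++ [c]}) →
          ∃ x : ℕ → D, t <+: initSeg x (max t.length (σ.length + 1)) ∧
            σ ++ [c] <+: initSeg x (max t.length (σ.length + 1)) := by
        intro c hc
        by_contra! hno
        apply hc
        convert isMillerSmall_empty I
        rw [eq_empty_iff_forall_notMem]
        rintro x ⟨⟨-, hx1⟩, hx2⟩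
        refine hno x ?_ ?_
        · conv_lhs => rw [← hx1]
          exact initSeg_prefix _ (le_max_left _ _)
        · rw [← hx2]
          exact initSeg_prefix _ (le_max_right _ _)
      obtain ⟨x, hx1, hx2⟩ := key a ha
      obtain ⟨y, hy1, hy2⟩ := key b hb
      rcases le_or_gt t.length σ.length with hle | hlt
      · exact List.prefix_of_prefix_length_le hx1 ((List.prefix_append _ _).trans hx2) hle
      · have h1 := List.prefix_of_prefix_length_le hx2 hx1 (by simp; omega)
        have h2 := List.prefix_of_prefix_length_le hy2 hy1 (by simp; omega)
        have := List.prefix_of_prefix_length_le h1 h2 (by simp)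
        simp at this
        exact absurd this hab
    -- The front is the finite path from `t` to the leaf `σ`; no infinite sequence stays in it.
    refine ⟨{τ | t <+: τ ∧ τ <+: σ}, ⟨List.prefix_rfl, htσ⟩, ?_, ?_⟩
    · rintro τ ⟨h1, r, rfl⟩
      rcases r with _ | ⟨d, r⟩
      · left
        intro hleaf
        refine hσ (I.lower (fun d hd => ?_) hleaf)
        refine hsucc _ _ fun hs => hd (hs.mono ?_)
        rintro x ⟨⟨hx1, hx2⟩, hx3⟩
        exact ⟨hx1, by simpa using hx3⟩
      · exact Or.inr ⟨d, h1.trans (List.prefix_append _ _), by simp⟩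
    · intro x m hm
      have := (hm (max m (σ.length + 1)) (le_max_left _ _)).2.length_le
      simp at this
  obtain ⟨T, hnil, -, hT, hbody⟩ := exists_fusion_tree (I := I) (P := Set.Nonempty) (N := N)
    (s := []) (fun A hA => (nontrivial_of_notMem hI hA).nonempty) hfront
    (by rw [← cylinderImage_nil] at h; simpa [N] using h)
  refine ⟨T, ⟨by simpa using hnil, fun σ hσ => ?_⟩,
    fun x hx => body_subset_range hf hne (hbody x hx).2⟩
  obtain ⟨x, hx⟩ := exists_branch (P := {t | t ∈ T}) (s := σ) hσ
    fun t ht _ => hT t ht List.nil_prefix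
  obtain ⟨m, hm, hpos⟩ := (hbody x (mem_body_iff_of_le σ.length fun n hn => (hx n hn).2)).1 σ.length
  exact ⟨_, (hx m hm).2, (hx m hm).1, hpos⟩

/-! ### The Laver dichotomy. -/

/-- The player who names sets of `I` can force that, from `t` on, no branch outside these sets
belongs to `X`. -/
def IsLaverSmall (I : Order.Ideal (Set D)) (t : List D) (X : Set (ℕ → D)) : Prop :=
  ∃ φ : List D → Set D, (∀ l, φ l ∈ I) ∧
    ∀ x ∈ X, initSeg x t.length = t → ∃ n ≥ t.length, x n ∈ φ (initSeg x n)

theorem isLaverSmall_of_successors {I : Order.Ideal (Set D)} {t : List D} {X : Set (ℕ → D)}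
    (h : {d | ¬ IsLaverSmall I (t ++ [d]) X} ∈ I) : IsLaverSmall I t X := by
  have : ∀ d, ∃ φ : List D → Set D, (∀ l, φ l ∈ I) ∧ (IsLaverSmall I (t ++ [d]) X →
      ∀ x ∈ X, initSeg x (t ++ [d]).length = t ++ [d] →
        ∃ n ≥ (t ++ [d]).length, x n ∈ φ (initSeg x n)) := by
    intro d
    by_cases hd : IsLaverSmall I (t ++ [d]) X
    · obtain ⟨φ, h1, h2⟩ := hd
      exact ⟨φ, h1, fun _ => h2⟩
    · exact ⟨fun _ => ∅, fun _ => Order.Ideal.bot_mem I, fun h => absurd h hd⟩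
  choose φ h1 h2 using this
  -- Only the `φ d` with `d` the entry after `t` is needed; the union over all entries of `l`
  -- contains it and is still finite.
  refine ⟨fun l => {d | ¬ IsLaverSmall I (t ++ [d]) X} ∪ ⋃ d ∈ {d | d ∈ l}, φ d l,
    fun l => Order.Ideal.sup_mem h ?_, fun x hx hxt => ?_⟩
  · exact (Order.Ideal.biSup_mem_iff l.finite_toSet).2 fun d _ => h1 d l
  · by_cases hd : IsLaverSmall I (t ++ [x t.length]) X
    · obtain ⟨n, hn, hxn⟩ := h2 _ hd x hx (by simp [initSeg_succ, hxt])
      simp only [List.length_append, List.length_singleton] at hn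
      refine ⟨n, by omega, Or.inr (mem_biUnion (x := x t.length) ?_ hxn)⟩
      have : x t.length ∈ initSeg x (t.length + 1) := by simp [initSeg_succ]
      exact (initSeg_prefix x hn).subset this
    · refine ⟨t.length, le_rfl, Or.inl hd⟩

/-- Call a node good if it has a front. Leaves are good, and so are nodes with positively many good
successors, by gluing fronts. So the player naming sets can keep the sequence among bad nodes. A bad
node is not a leaf, hence small for each `u ++ [j]`; combining these strategies makes a bad `t`
small for `u`. -/
theorem exists_front_of_not_isLaverSmall {I : Order.Ideal (Set D)} {f : (ℕ → ℕ) → ℕ → D}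
    {t : List D} {u : List ℕ} (h : ¬ IsLaverSmall I t (cylinderImage f u)) :
    ∃ F, t ∈ F ∧
      IsFront I (· ∉ I) (fun t u => ¬ IsLaverSmall I t (cylinderImage f u)) u F := by
  set N : List D → List ℕ → Prop := fun t u => ¬ IsLaverSmall I t (cylinderImage f u) with hN
  set att : List D → Prop := fun t => ∃ F, t ∈ F ∧ IsFront I (· ∉ I) N u F with hatt
  change att t
  have hleaf : ∀ t, IsLeaf I N u t → att t := by
    intro t ht
    refine ⟨{t}, rfl, ?_, ?_⟩
    · rintro _ rfl
      exact Or.inl ht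
    · intro x m hm
      have h1 := congrArg List.length (hm (m + t.length + 1) (by omega) : _ = t)
      simp at h1
      omega
  have hsucc : ∀ t, {d | att (t ++ [d])} ∉ I → att t := by
    intro t ht
    choose! F hFmem hF using fun d (hd : att (t ++ [d])) => hd
    refine ⟨{t} ∪ ⋃ d ∈ {d | att (t ++ [d])}, {τ ∈ F d | t ++ [d] <+: τ}, Or.inl rfl, ?_, ?_⟩
    · rintro τ (rfl | hτ)
      · refine Or.inr fun h' => ht (I.lower (fun d hd => Or.inr ?_) h')
        exact mem_iUnion₂.2 ⟨d, hd, hFmem d hd, List.prefix_rfl⟩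
      · obtain ⟨d, hd, hτF, hpre⟩ := mem_iUnion₂.1 hτ
        refine ((hF d hd).1 τ hτF).imp id fun hpos h' => hpos (I.lower (fun e he => Or.inr ?_) h')
        exact mem_iUnion₂.2 ⟨d, hd, he, hpre.trans (List.prefix_append _ _)⟩
    · intro x m hm
      have key : ∀ n ≥ max m (t.length + 1), att (t ++ [x t.length]) ∧
          initSeg x n ∈ F (x t.length) := by
        intro n hn
        rcases hm n (by omega) with h1 | h1
        · have := congrArg List.length (h1 : initSeg x n = t)
          simp at this
          omega
        · obtain ⟨d, hd, hxF, hpre⟩ := mem_iUnion₂.1 h1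
          have e := initSeg_eq_of_prefix hpre
          simp only [List.length_append, List.length_singleton, initSeg_succ] at e
          have := (List.append_inj' e rfl).2
          simp only [List.cons.injEq, and_true] at this
          rw [this]
          exact ⟨hd, hxF⟩
      obtain ⟨n, hn, hl⟩ := (hF _ (key _ le_rfl).1).2 x _ fun n hn => (key n hn).2
      exact ⟨n, by omega, hl⟩
  by_contra hcon
  apply h
  have hsmall : ∀ l, ¬ att l → ∀ j, IsLaverSmall I l (cylinderImage f (u ++ [j])) := by
    intro l hl j
    refine isLaverSmall_of_successors ?_
    by_contra hpos
    refine hl (hleaf l fun h' => hpos (I.lower ?_ h'))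
    exact fun d hd => ⟨j, hd⟩
  have : ∀ (l : List D) (j : ℕ), ∃ φ : List D → Set D, (∀ l, φ l ∈ I) ∧ (¬ att l →
      ∀ x ∈ cylinderImage f (u ++ [j]), initSeg x l.length = l →
        ∃ n ≥ l.length, x n ∈ φ (initSeg x n)) := by
    intro l j
    by_cases hl : att l
    · exact ⟨fun _ => ∅, fun _ => Order.Ideal.bot_mem I, fun h => absurd hl h⟩
    · obtain ⟨φ, h1, h2⟩ := hsmall l hl j
      exact ⟨φ, h1, fun _ => h2⟩
  choose φ h1 h2 using this
  -- The strategy against `u ++ [j]` is started only at length `max t.length j`, so at `l` only `j ≤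
  -- l.length` matter and the union is finite.
  refine ⟨fun l => {d | ¬ att l ∧ att (l ++ [d])} ∪
    ⋃ k ∈ Iic l.length, ⋃ j ∈ Iic l.length, φ (l.take k) j l,
    fun l => Order.Ideal.sup_mem ?_ ?_, fun x hx hxt => ?_⟩
  · by_cases hl : att l
    · simpa [hl] using Order.Ideal.bot_mem I
    · have := mt (hsucc l) hl
      simpa [hl] using this
  · exact (Order.Ideal.biSup_mem_iff (finite_Iic _)).2 fun k _ =>
      (Order.Ideal.biSup_mem_iff (finite_Iic _)).2 fun j _ => h1 _ j l
  · by_contra! hno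
    have hout : ∀ n ≥ t.length, ¬ att (initSeg x n) := by
      intro n hn
      induction n, hn using Nat.le_induction with
      | base => rwa [hxt]
      | succ n hn ih =>
        intro ha
        refine hno n hn (Or.inl ⟨ih, ?_⟩)
        rwa [← initSeg_succ]
    obtain ⟨j, hj⟩ := mem_cylinderImage_succ hx
    obtain ⟨n, hn, hxn⟩ := h2 _ j (hout (max t.length j) (le_max_left _ _)) x hj (by simp)
    rw [length_initSeg] at hn
    refine hno n (by omega) (Or.inr ?_)
    refine mem_biUnion (x := max t.length j) (by simpa using hn)
      (mem_biUnion (x := j) (by simp; omega) ?_)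
    convert hxn using 2
    have := initSeg_prefix x hn
    rw [List.prefix_iff_eq_take] at this
    simpa using this.symm

theorem exists_laver_body_subset_range [TopologicalSpace D] [DiscreteTopology D]
    {I : Order.Ideal (Set D)} (hI : ∀ d, {d} ∈ I) {f : (ℕ → ℕ) → ℕ → D} (hf : Continuous f)
    {s : List D} (h : ¬ IsLaverSmall I s (range f)) :
    ∃ T ∈ laverTrees I, body T ⊆ range f := by
  obtain ⟨T, hs, hcomp, hT, hbody⟩ := exists_fusion_tree (I := I) (P := (· ∉ I))
    (N := fun t u => ¬ IsLaverSmall I t (cylinderImage f u)) (s := s) (fun A hA => hA)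
    (fun t u => exists_front_of_not_isLaverSmall) (by simpa [cylinderImage_nil] using h)
  refine ⟨T, mem_laverTrees_of_stem hI hs hcomp hT,
    fun x hx => body_subset_range hf
      (N := fun t u => ¬ IsLaverSmall I t (cylinderImage f u)) (fun t u htu => ?_) (hbody x hx).2⟩
  by_contra! hno
  exact htu ⟨fun _ => ∅, fun _ => Order.Ideal.bot_mem I, fun x hx hxt => absurd hxt (hno x hx)⟩

/-! ### Smallness of the Borel members of the tree ideals. -/

theorem polishSpace_of_countable_discrete [Countable D] [TopologicalSpace D]
    [DiscreteTopology D] : PolishSpace D := by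
  obtain ⟨g, hg⟩ := exists_injective_nat D
  have : IsClosedEmbedding g := .of_continuous_injective_isClosedMap
    continuous_of_discreteTopology hg fun _ _ => isClosed_discrete _
  exact this.polishSpace

theorem IsBorel.isMillerSmall [Countable D] {I : Order.Ideal (Set D)} (hI : ∀ d, {d} ∈ I)
    {C : Set (ℕ → D)} (hC : IsBorel C) (h : C ∈ treeIdeal (millerTrees I)) :
    IsMillerSmall I C := by
  let _ : TopologicalSpace D := ⊥
  have _ : DiscreteTopology D := ⟨rfl⟩
  let _ : MeasurableSpace (ℕ → D) := borel _
  have _ : BorelSpace (ℕ → D) := ⟨rfl⟩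
  have := polishSpace_of_countable_discrete (D := D)
  have hC : MeasurableSet C := hC
  have ha := hC.analyticSet
  rw [MeasureTheory.AnalyticSet] at ha
  rcases ha with rfl | ⟨f, hf, rfl⟩
  · exact isMillerSmall_empty I
  · by_contra hs
    obtain ⟨T, hT, hb⟩ := exists_miller_body_subset_range hI hf hs
    exact not_body_subset_of_mem_treeIdeal (fun _ => body_nonempty_of_miller) h hT hb

theorem IsBorel.isLaverSmall [Countable D] {I : Order.Ideal (Set D)} (hI : ∀ d, {d} ∈ I)
    {C : Set (ℕ → D)} (hC : IsBorel C) (h : C ∈ treeIdeal (laverTrees I)) (s : List D) :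
    IsLaverSmall I s C := by
  let _ : TopologicalSpace D := ⊥
  have _ : DiscreteTopology D := ⟨rfl⟩
  let _ : MeasurableSpace (ℕ → D) := borel _
  have _ : BorelSpace (ℕ → D) := ⟨rfl⟩
  have := polishSpace_of_countable_discrete (D := D)
  have hC : MeasurableSet C := hC
  have ha := hC.analyticSet
  rw [MeasureTheory.AnalyticSet] at ha
  rcases ha with rfl | ⟨f, hf, rfl⟩
  · exact ⟨fun _ => ∅, fun _ => Order.Ideal.bot_mem I, by simp⟩
  · by_contra hs
    obtain ⟨T, hT, hb⟩ := exists_laver_body_subset_range hI hf hs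
    exact not_body_subset_of_mem_treeIdeal (fun _ => body_nonempty_of_laver) h hT hb

/-! ### Additivity -/

theorem isBorel_forall_mem (A : Set D) : IsBorel {z : ℕ → D | ∀ n, z n ∈ A} := by
  let _ : TopologicalSpace D := ⊥
  have _ : DiscreteTopology D := ⟨rfl⟩
  let _ : MeasurableSpace (ℕ → D) := borel _
  have _ : BorelSpace (ℕ → D) := ⟨rfl⟩
  have : IsClosed {z : ℕ → D | ∀ n, z n ∈ A} := by
    simp only [ofPred_forall]
    exact isClosed_iInter fun n => (isClosed_discrete A).preimage (continuous_apply n)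
  exact this.measurableSet

theorem sUnion_mem_sigmaIdealGen {X : Type} {𝒢 ℱ : Set (Set X)} (hℱ : ℱ ⊆ sigmaIdealGen 𝒢)
    (hc : ℱ.Countable) : ⋃₀ ℱ ∈ sigmaIdealGen 𝒢 := by
  choose! 𝒞 h1 h2 h3 using fun F (hF : F ∈ ℱ) => hℱ hF
  refine ⟨⋃ F ∈ ℱ, 𝒞 F, iUnion₂_subset h1, hc.biUnion h2, sUnion_subset fun F hF => ?_⟩
  exact (h3 F hF).trans (sUnion_subset_sUnion (subset_biUnion_of_mem hF))

theorem add_sigmaIdealGen_eq_aleph_one {X ι : Type} {𝒢 : Set (Set X)} (hι : ℵ₁ ≤ #ι)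
    (h𝒢 : ∅ ∈ 𝒢) {K : ι → Set X} (hK : ∀ i, K i ∈ 𝒢)
    (hcount : ∀ C : ℕ → Set X, (∀ n, C n ∈ 𝒢) → {i | K i ⊆ ⋃ n, C n}.Countable) :
    add (sigmaIdealGen 𝒢) = ℵ₁ := by
  obtain ⟨W, hW⟩ := Cardinal.le_mk_iff_exists_set.1 hι
  have hsub : K '' W ⊆ sigmaIdealGen 𝒢 := by
    rintro _ ⟨i, -, rfl⟩
    exact ⟨{K i}, singleton_subset_iff.2 (hK i), countable_singleton _, by simp⟩
  have hnot : ⋃₀ (K '' W) ∉ sigmaIdealGen 𝒢 := by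
    rintro ⟨𝒞, h1, h2, h3⟩
    -- Adding `∅` makes the family nonempty, so that it can be enumerated.
    obtain ⟨C, hC⟩ := (h2.insert ∅).exists_eq_range (insert_nonempty _ _)
    have hc := hcount C fun n => by
      have : C n ∈ insert ∅ 𝒞 := hC ▸ mem_range_self n
      exact (insert_subset h𝒢 h1) this
    have hWc : W.Countable := hc.mono fun i hi => by
      refine (subset_sUnion_of_mem (mem_image_of_mem K hi)).trans (h3.trans ?_)
      rw [← sUnion_range, ← hC]
      exact sUnion_subset_sUnion (subset_insert _ _)
    rw [← le_aleph0_iff_set_countable, hW] at hWc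
    exact absurd hWc (not_le.2 aleph0_lt_aleph_one)
  apply le_antisymm
  · have : #(K '' W) ∈ {κ | ∃ ℱ ⊆ sigmaIdealGen 𝒢, ⋃₀ ℱ ∉ sigmaIdealGen 𝒢 ∧ #ℱ = κ} :=
      ⟨_, hsub, hnot, rfl⟩
    exact (csInf_le' this).trans (mk_image_le.trans hW.le)
  · refine le_csInf ⟨_, _, hsub, hnot, rfl⟩ ?_
    rintro κ ⟨ℱ, h1, h2, rfl⟩
    by_contra! hlt
    rw [Cardinal.lt_aleph_one_iff, le_aleph0_iff_set_countable] at hlt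
    exact h2 (sUnion_mem_sigmaIdealGen h1 hlt)

theorem add_borelPart_eq_aleph_one {ι : Type} [Countable D] {I : Order.Ideal (Set D)}
    (hI : ∀ d, {d} ∈ I) (hι : ℵ₁ ≤ #ι) {A : ι → Set D} (hA : ∀ i, A i ∈ I)
    (hcount : ∀ B ∈ I, {i | A i ⊆ B}.Countable) :
    add (borelPart (millerTrees I)) = ℵ₁ ∧ add (borelPart (laverTrees I)) = ℵ₁ := by
  have hempty : ∀ 𝕋 : Set (Descriptive.tree D), ∅ ∈ {A | A ∈ treeIdeal 𝕋 ∧ IsBorel A} :=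
    fun 𝕋 => ⟨fun T hT => ⟨T, hT, le_rfl, inter_empty _⟩, MeasurableSpace.measurableSet_empty _⟩
  constructor
  · refine add_sigmaIdealGen_eq_aleph_one hι (hempty _)
      (fun i => ⟨forall_mem_mem_treeIdeal_miller (hA i), isBorel_forall_mem (A i)⟩)
      fun C hC => ?_
    obtain ⟨Φ, h1, h2, h3⟩ := IsMillerSmall.iUnion fun n => (hC n).2.isMillerSmall hI (hC n).1
    obtain ⟨φ, hφ⟩ := (h1.insert fun _ => ∅).exists_eq_range (insert_nonempty _ _)
    have hφI : ∀ k l, φ k l ∈ I := by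
      intro k l
      have : φ k ∈ insert (fun _ => ∅) Φ := hφ ▸ mem_range_self k
      rcases this with h | h
      · rw [h]; exact Order.Ideal.bot_mem I
      · exact h2 _ h l
    refine (countable_iUnion fun k => countable_iUnion fun l => hcount _ (hφI k l)).mono ?_
    intro i hi
    by_contra hno
    simp only [mem_iUnion, not_exists, mem_ofPred_eq, not_subset] at hno
    -- Diagonalization: entry `k` of `x` defeats `φ k`, which suffices because a witness has to hold
    -- at every entry.
    obtain ⟨x, hx⟩ := exists_seq_of_initSeg (p := fun l d => d ∈ A i ∧ d ∉ φ l.length l)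
      fun l => hno _ _
    obtain ⟨ψ, hψ, hm⟩ := h3 x (hi fun n => (hx n).1)
    obtain ⟨k, rfl⟩ : ψ ∈ range φ := hφ ▸ mem_insert_of_mem _ hψ
    have := (hx k).2
    rw [length_initSeg] at this
    exact this (hm k)
  · refine add_sigmaIdealGen_eq_aleph_one hι (hempty _)
      (fun i => ⟨forall_mem_mem_treeIdeal_laver hI (hA i), isBorel_forall_mem (A i)⟩)
      fun C hC => ?_
    choose φ h1 h2 using fun n s => (hC n).2.isLaverSmall hI (hC n).1 s
    -- The strategy against `C k` is started at length `k`, so finitely many strategies are active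
    -- at each node, and `x` can avoid them all.
    have hmem : ∀ l : List D, (⋃ k ∈ Iic l.length, φ k (l.take k) l) ∈ I := fun l =>
      (Order.Ideal.biSup_mem_iff (finite_Iic _)).2 fun k _ => h1 k _ l
    refine (countable_iUnion fun l => hcount _ (hmem l)).mono ?_
    intro i hi
    by_contra hno
    simp only [mem_iUnion, not_exists, mem_ofPred_eq, not_subset] at hno
    obtain ⟨x, hx⟩ := exists_seq_of_initSeg hno
    obtain ⟨k, hk⟩ := mem_iUnion.1 (hi fun n => (hx n).1)
    obtain ⟨n, hn, hxn⟩ := h2 k (initSeg x k) x hk (by simp)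
    rw [length_initSeg] at hn
    have := initSeg_prefix x hn
    rw [List.prefix_iff_eq_take, length_initSeg] at this
    rw [this] at hxn
    exact (hx n).2 k (by simpa using hn) hxn

end TreeIdeals

namespace TreeIdeals

/-! ### Large families in the five ideals. -/

theorem aleph_one_le_mk_cantor : ℵ₁ ≤ #(ℕ → Bool) := by
  simpa using aleph_one_le_continuum

theorem eventually_injOn_initSeg {D : Type} {s : Set (ℕ → D)} (hs : s.Finite) :
    ∀ᶠ n in atTop, InjOn (initSeg · n) s := by
  have : ∀ p ∈ s ×ˢ s, ∀ᶠ n in atTop, initSeg p.1 n = initSeg p.2 n → p.1 = p.2 := by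
    rintro ⟨x, y⟩ -
    by_cases h : x = y
    · exact Eventually.of_forall fun _ _ => h
    · obtain ⟨i, hi⟩ := Function.ne_iff.1 h
      filter_upwards [eventually_gt_atTop i] with n hn he
      exact absurd (initSeg_eq_iff.1 he i hn) hi
  filter_upwards [(eventually_all_finite (hs.prod hs)).2 this] with n hn x hx y hy h
  exact hn (x, y) ⟨hx, hy⟩ h

/-! ### The ideals `ED` and `ED_fin` -/

/-- A number below `2 ^ k`, for `k` the binary logarithm of `a`, that codes `x|k`. -/
noncomputable def initSegCode (x : ℕ → Bool) (a : ℕ) : ℕ :=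
  Fintype.equivFin (Fin (Nat.log 2 a) → Bool) fun i => x i

theorem initSegCode_le (x : ℕ → Bool) (a : ℕ) : initSegCode x a ≤ a := by
  have h : initSegCode x a < 2 ^ Nat.log 2 a :=
    (Fin.is_lt _).trans_eq (by simp)
  rcases eq_or_ne a 0 with rfl | ha
  · simpa using h
  · exact h.le.trans (Nat.pow_log_le_self 2 ha)

theorem initSegCode_injOn {s : Set (ℕ → Bool)} {a : ℕ}
    (h : InjOn (initSeg · (Nat.log 2 a)) s) : InjOn (initSegCode · a) s := by
  intro x hx y hy hxy
  have := (Fintype.equivFin (Fin (Nat.log 2 a) → Bool)).injective (Fin.val_injective hxy)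
  exact h hx hy (by simp only [initSeg]; rw [this])

/-- The set is even finite: `N + 1` different points have different codes at all large `a`, too many
for a section of size at most `N`. -/
theorem countable_of_code_subset_ED {B : Set (ℕ × ℕ)} (hB : B ∈ idealED) :
    {x : ℕ → Bool | ∀ a, (a, initSegCode x a) ∈ B}.Countable := by
  obtain ⟨N, hN⟩ := hB
  apply Set.Finite.countable
  by_contra hinf
  obtain ⟨s, hs, hcard⟩ := Set.Infinite.exists_subset_card_eq hinf (N + 1)
  have hev : ∀ᶠ a in atTop, InjOn (initSegCode · a) (s : Set (ℕ → Bool)) :=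
    ((tendsto_atTop_atTop.2 fun b =>
      ⟨2 ^ b, fun a h => Nat.le_log_of_pow_le one_lt_two h⟩).eventually
      (eventually_injOn_initSeg s.finite_toSet)).mono fun a => initSegCode_injOn
  obtain ⟨a, ha, haN⟩ := (hev.and (eventually_gt_atTop N)).exists
  have h1 : ((initSegCode · a) '' (s : Set (ℕ → Bool))).encard ≤ N :=
    (encard_le_encard (by rintro _ ⟨x, hx, rfl⟩; exact hs hx a)).trans (hN a haN)
  rw [ha.encard_image, encard_coe_eq_coe_finsetCard, hcard] at h1
  norm_cast at h1
  omega

theorem mem_idealED_of_graph {B : Set (ℕ × ℕ)} {f : ℕ → ℕ} (h : ∀ p ∈ B, p.2 = f p.1) :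
    B ∈ idealED := by
  refine ⟨1, fun n _ => ?_⟩
  refine (encard_le_encard (t := {f n}) ?_).trans (by simp)
  exact fun m hm => h _ hm

theorem add_idealED : add (borelPart (millerTrees idealED)) = ℵ₁ ∧
    add (borelPart (laverTrees idealED)) = ℵ₁ := by
  refine add_borelPart_eq_aleph_one (A := fun x : ℕ → Bool => {p | p.2 = initSegCode x p.1})
    (fun d => mem_idealED_of_graph (f := fun _ => d.2) ?_) aleph_one_le_mk_cantor
    (fun x => mem_idealED_of_graph fun p hp => hp) fun B hB => ?_
  · rintro _ rfl
    rfl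
  · refine (countable_of_code_subset_ED hB).mono ?_
    intro x hx a
    exact hx (show (a, initSegCode x a).2 = _ from rfl)

theorem add_idealEDfin : add (borelPart (millerTrees idealEDfin)) = ℵ₁ ∧
    add (borelPart (laverTrees idealEDfin)) = ℵ₁ := by
  refine add_borelPart_eq_aleph_one
    (A := fun x : ℕ → Bool => {p : BelowDiag | p.1.2 = initSegCode x p.1.1})
    (fun d => mem_idealED_of_graph (f := fun _ => d.1.2) ?_) aleph_one_le_mk_cantor
    (fun x => mem_idealED_of_graph (f := initSegCode x) ?_) fun B hB => ?_
  · rintro _ ⟨_, rfl, rfl⟩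
    rfl
  · rintro _ ⟨p, hp, rfl⟩
    exact hp
  · refine (countable_of_code_subset_ED hB).mono ?_
    intro x hx a
    let p : BelowDiag := ⟨(a, initSegCode x a), initSegCode_le x a⟩
    exact ⟨p, hx (show p.1.2 = _ from rfl), rfl⟩

/-! ### The Solecki ideal -/

theorem cantorMeasure_restrict_preimage (n : ℕ) (S : Finset (Fin n → Bool)) :
    cantorMeasure {x | (fun i : Fin n => x i) ∈ S} = S.card / 2 ^ n := by
  have hpt : ∀ s : Fin n → Bool,
      cantorMeasure {x | (fun i : Fin n => x i) = s} = 1 / 2 ^ n := by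
    intro s
    have : {x : ℕ → Bool | (fun i : Fin n => x i) = s} =
        (Finset.range n : Set ℕ).pi fun i => {b | ∀ h : i < n, b = s ⟨i, h⟩} := by
      ext x
      simp only [mem_ofPred_eq, funext_iff, Set.mem_pi, Finset.coe_range, mem_Iio]
      exact ⟨fun h i _ hi => h ⟨i, hi⟩, fun h i => h i i.2 i.2⟩
    rw [this, cantorMeasure, MeasureTheory.Measure.infinitePi_pi _ fun i _ => MeasurableSet.of_discrete]
    rw [Finset.prod_congr rfl (g := fun _ => (2 : ENNReal)⁻¹)]
    · simp [ENNReal.inv_pow]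
    · intro i hi
      have hi : i < n := by simpa using hi
      have : {b : Bool | ∀ h : i < n, b = s ⟨i, h⟩} = {s ⟨i, hi⟩} := by
        ext b
        simp [hi]
      rw [this, PMF.toMeasure_apply_singleton _ _ (MeasurableSet.singleton _)]
      simp
  have hU : {x : ℕ → Bool | (fun i : Fin n => x i) ∈ S} =
      ⋃ s ∈ S, {x | (fun i : Fin n => x i) = s} := by
    ext x
    simp
  rw [hU, MeasureTheory.measure_biUnion_finset]
  · simp [hpt, div_eq_mul_inv]
  · intro s _ t _ hst
    rw [Function.onFun, Set.disjoint_left]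
    rintro x rfl h
    exact hst h
  · intro s _
    have : Measurable fun (x : ℕ → Bool) (i : Fin n) => x i :=
      measurable_pi_lambda _ fun i => measurable_pi_apply _
    exact this (MeasurableSet.singleton s)

theorem exists_halfClopen {F : Set (ℕ → Bool)} (hF : F.Finite) {x : ℕ → Bool} (hx : x ∉ F) :
    ∃ C : HalfClopens, x ∈ C.1 ∧ ∀ y ∈ F, y ∉ C.1 := by
  classical
  obtain ⟨F, rfl⟩ := hF.exists_finset_coe
  obtain ⟨n, hn, hcard⟩ := ((eventually_injOn_initSeg ((F.finite_toSet).insert x)).and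
    (eventually_gt_atTop F.card)).exists
  let r : (ℕ → Bool) → Fin (n + 1) → Bool := fun y i => y i
  have hr : ∀ y ∈ F, r y ≠ r x := by
    intro y hy h
    have : initSeg y n = initSeg x n :=
      initSeg_eq_iff.2 fun i hi => congrFun h ⟨i, by omega⟩
    have := hn (mem_insert_of_mem _ hy) (mem_insert _ _) this
    exact hx (this ▸ hy)
  have h2n : n < 2 ^ n := Nat.lt_two_pow_self
  -- Half of the `2 ^ (n + 1)` patterns are chosen. There is room, since `F` forbids at most `F.card
  -- < n < 2 ^ n` of them.
  obtain ⟨S, hS1, hS2, hS⟩ := Finset.exists_subsuperset_card_eq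
    (s := {r x}) (t := (F.image r)ᶜ) (n := 2 ^ n)
    (by simpa using fun y hy => hr y hy) (by simp; omega) (by
      rw [Finset.card_compl]
      have := F.card_image_le (f := r)
      simp [pow_succ]
      omega)
  have hcont : Continuous r := continuous_pi fun i => continuous_apply _
  refine ⟨⟨⟨r ⁻¹' S, (isClopen_discrete _).preimage hcont⟩, ?_⟩, ?_, ?_⟩
  · refine (cantorMeasure_restrict_preimage (n + 1) S).trans ?_
    rw [hS, pow_succ]
    push_cast
    rw [ENNReal.div_eq_div_iff] <;> simp [mul_comm, ENNReal.mul_eq_top]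
  · exact hS1 (Finset.mem_singleton_self _)
  · intro y hy h
    have := hS2 h
    simp only [Finset.mem_compl, Finset.mem_image, not_exists, not_and] at this
    exact this y hy rfl

theorem mem_idealSolecki_iff {B : Set HalfClopens} : B ∈ idealSolecki ↔
    ∃ F : Set (ℕ → Bool), F.Finite ∧ ∀ C ∈ B, ∃ x ∈ F, x ∈ C.1 := by
  constructor
  · rintro ⟨ℱ, h1, h2, h3⟩
    choose! F hF hF' using fun A (hA : A ∈ ℱ) => h1 hA
    refine ⟨⋃ A ∈ ℱ, F A, h2.biUnion fun A hA => hF A hA, fun C hC => ?_⟩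
    obtain ⟨A, hA, hCA⟩ := h3 hC
    rw [hF' A hA] at hCA
    obtain ⟨x, hx, hxF⟩ := hCA
    exact ⟨x, mem_biUnion hA hxF, hx⟩
  · rintro ⟨F, hF, h⟩
    refine ⟨{{C | ((C.1 : Set (ℕ → Bool)) ∩ F).Nonempty}},
      singleton_subset_iff.2 ⟨F, hF, rfl⟩, finite_singleton _, ?_⟩
    rw [sUnion_singleton]
    intro C hC
    obtain ⟨x, hx, hxC⟩ := h C hC
    exact ⟨x, hxC, hx⟩

theorem add_idealSolecki : add (borelPart (millerTrees idealSolecki)) = ℵ₁ ∧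
    add (borelPart (laverTrees idealSolecki)) = ℵ₁ := by
  have : Countable (TopologicalSpace.Clopens (ℕ → Bool)) :=
    TopologicalSpace.Clopens.countable_iff_secondCountable.2 inferInstance
  refine add_borelPart_eq_aleph_one (A := fun x : ℕ → Bool => {C | x ∈ C.1})
    (fun C => mem_idealSolecki_iff.2 ?_) aleph_one_le_mk_cantor
    (fun x => mem_idealSolecki_iff.2 ⟨{x}, finite_singleton x, fun C hC => ⟨x, rfl, hC⟩⟩)
    fun B hB => ?_
  · obtain ⟨x, hx⟩ : (C.1 : Set (ℕ → Bool)).Nonempty := by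
      rw [nonempty_iff_ne_empty]
      intro h
      have := C.2
      rw [h, MeasureTheory.measure_empty] at this
      exact absurd this.symm (by simp)
    refine ⟨{x}, finite_singleton x, ?_⟩
    rintro _ rfl
    exact ⟨x, rfl, hx⟩
  · obtain ⟨F, hF, h⟩ := mem_idealSolecki_iff.1 hB
    refine hF.countable.mono fun x hx => ?_
    by_contra hxF
    obtain ⟨C, hxC, hC⟩ := exists_halfClopen hF hxF
    obtain ⟨y, hy, hyC⟩ := h C (hx hxC)
    exact hC y hy hyC

/-! ### The ideal `conv` -/

theorem exists_seq_rat_tendsto {r : ℝ} (hr : r ∈ Ioo (0 : ℝ) 1) :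
    ∃ u : ℕ → Icc (0 : ℚ) 1, Tendsto (fun n => ((u n : ℚ) : ℝ)) atTop (𝓝 r) ∧
      ∀ n, ((u n : ℚ) : ℝ) < r := by
  have : ∀ n : ℕ, ∃ q : ℚ, max 0 (r - 1 / ((n : ℝ) + 1)) < q ∧ (q : ℝ) < r := fun n =>
    exists_rat_btwn (max_lt hr.1 (sub_lt_self _ (by positivity)))
  choose q hq hqr using this
  refine ⟨fun n => ⟨q n, ?_, ?_⟩, ?_, hqr⟩
  · exact_mod_cast ((le_max_left _ _).trans_lt (hq n)).le
  · exact_mod_cast ((hqr n).trans hr.2).le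
  · refine tendsto_of_tendsto_of_tendsto_of_le_of_le (g := fun n : ℕ => r - 1 / ((n : ℝ) + 1))
      ?_ tendsto_const_nhds (fun n => ((le_max_right _ _).trans_lt (hq n)).le)
      fun n => (hqr n).le
    simpa using tendsto_const_nhds.sub (tendsto_one_div_add_atTop_nhds_zero_nat (𝕜 := ℝ))

/-- Disjoint neighbourhoods of `r` and `l` take care of the tail of `v`. Each of the finitely many
earlier terms is eventually avoided, even one equal to `r`, because `u` never takes that value. -/
theorem eventually_notMem_range {u v : ℕ → ℝ} {r l : ℝ} (hu : Tendsto u atTop (𝓝 r))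
    (hur : ∀ n, u n ≠ r) (hv : Tendsto v atTop (𝓝 l)) (hrl : r ≠ l) :
    ∀ᶠ n in atTop, u n ∉ range v := by
  obtain ⟨U, V, hU, hV, hrU, hlV, hUV⟩ := t2_separation hrl
  obtain ⟨M, hM⟩ := eventually_atTop.1 (hv.eventually (hV.mem_nhds hlV))
  have h1 : ∀ᶠ n in atTop, ∀ m ∈ Iio M, u n ≠ v m := by
    rw [eventually_all_finite (finite_Iio M)]
    intro m _
    by_cases h : r = v m
    · exact Eventually.of_forall fun n => h ▸ hur n
    · exact hu.eventually_ne h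
  filter_upwards [h1, hu.eventually (hU.mem_nhds hrU)] with n hn hnU
  rintro ⟨m, hm⟩
  rcases lt_or_ge m M with h | h
  · exact hn m h hm.symm
  · exact disjoint_left.1 hUV hnU (hm ▸ hM m h)

theorem add_idealConv : add (borelPart (millerTrees idealConv)) = ℵ₁ ∧
    add (borelPart (laverTrees idealConv)) = ℵ₁ := by
  choose u hu hur using fun r : Ioo (0 : ℝ) 1 => exists_seq_rat_tendsto r.2
  refine add_borelPart_eq_aleph_one (A := fun r => range (u r)) (fun d => ?_) ?_ (fun r => ?_)
    fun B hB => ?_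
  · exact ⟨{{d}}, singleton_subset_iff.2 ⟨fun _ => d, _, tendsto_const_nhds, by simp⟩,
      finite_singleton _, by simp⟩
  · rw [mk_Ioo_real zero_lt_one]
    exact aleph_one_le_continuum
  · exact ⟨{range (u r)}, singleton_subset_iff.2 ⟨u r, r, hu r, rfl⟩, finite_singleton _, by simp⟩
  · obtain ⟨ℱ, h1, h2, h3⟩ := hB
    choose! v l hv hrange using fun A (hA : A ∈ ℱ) => h1 hA
    have hfin : {r : Ioo (0 : ℝ) 1 | (r : ℝ) ∈ l '' ℱ}.Finite :=
      (h2.image l).preimage Subtype.val_injective.injOn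
    refine hfin.countable.mono fun r hr => ?_
    by_contra hno
    have : ∀ᶠ n in atTop, ∀ A ∈ ℱ, ((u r n : ℚ) : ℝ) ∉ range fun m => ((v A m : ℚ) : ℝ) := by
      rw [eventually_all_finite h2]
      exact fun A hA => eventually_notMem_range (hu r) (fun n => (hur r n).ne) (hv A hA)
        fun h => hno ⟨A, hA, h.symm⟩
    obtain ⟨n, hn⟩ := this.exists
    obtain ⟨A, hA, hnA⟩ := h3 (hr (mem_range_self n))
    rw [hrange A hA] at hnA
    obtain ⟨m, hm⟩ := hnA
    exact hn A hA ⟨m, by simp only [hm]⟩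

/-! ### The random graph ideal -/

theorem IsRandomGraph.exists_embedding {G : SimpleGraph ℕ} (hG : IsRandomGraph G)
    (R : ℕ → ℕ → Prop) :
    ∃ w : ℕ → ℕ, ∀ m n, m < n → w n ≠ w m ∧ (G.Adj (w n) (w m) ↔ R m n) := by
  classical
  let step : ∀ n, (∀ m < n, ℕ) → ℕ := fun n w =>
    let A := (Finset.univ.filter fun m : Fin n => R m n).image fun m : Fin n => w m m.2
    let B := (Finset.univ.filter fun m : Fin n => ¬ R m n).image fun m : Fin n => w m m.2
    -- The value `0` is never used: earlier vertices are distinct, so `A` and `B` are disjoint.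
    if h : Disjoint A B then (hG A B h).choose else 0
  let w : ℕ → ℕ := fun n => Nat.strongRec step n
  have hw : ∀ n, w n = step n fun m _ => w m := fun n => by
    simp only [w]
    rw [Nat.strongRec]
  refine ⟨w, fun m n => ?_⟩
  induction n using Nat.strong_induction_on generalizing m with
  | _ n ih =>
    intro hmn
    have hinj : ∀ a < n, ∀ b < n, w a = w b → a = b := by
      intro a ha b hb hab
      rcases lt_trichotomy a b with h | h | h
      · exact absurd hab.symm (ih b hb a h).1
      · exact h
      · exact absurd hab (ih a ha b h).1
    have hdisj : Disjoint
        ((Finset.univ.filter fun m : Fin n => R m n).image fun m : Fin n => w m)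
        ((Finset.univ.filter fun m : Fin n => ¬ R m n).image fun m : Fin n => w m) := by
      rw [Finset.disjoint_left]
      intro v hv hv'
      obtain ⟨a, ha, rfl⟩ := Finset.mem_image.1 hv
      obtain ⟨b, hb, hab⟩ := Finset.mem_image.1 hv'
      have := hinj b b.2 a a.2 hab
      simp only [Finset.mem_filter, Finset.mem_univ, true_and] at ha hb
      exact hb (this ▸ ha)
    obtain ⟨h1, h2, h3, h4⟩ := (hG _ _ hdisj).choose_spec
    have hwn : w n = (hG _ _ hdisj).choose := by
      rw [hw]
      exact dif_pos hdisj
    rw [← hwn] at h1 h2 h3 h4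
    by_cases hR : R m n
    · have hm : w m ∈ (Finset.univ.filter fun m : Fin n => R m n).image fun m : Fin n => w m :=
        Finset.mem_image.2 ⟨⟨m, hmn⟩, by simpa using hR, rfl⟩
      exact ⟨fun h => h1 (h ▸ hm), iff_of_true (h3 _ hm) hR⟩
    · have hm : w m ∈ (Finset.univ.filter fun m : Fin n => ¬ R m n).image fun m : Fin n => w m :=
        Finset.mem_image.2 ⟨⟨m, hmn⟩, by simpa using hR, rfl⟩
      exact ⟨fun h => h2 (h ▸ hm), iff_of_false (h4 _ hm) hR⟩

theorem IsRandomGraph.exists_comparability_embedding {G : SimpleGraph ℕ}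
    (hG : IsRandomGraph G) :
    ∃ v : List Bool → ℕ, ∀ s t, s ≠ t → v s ≠ v t ∧ (G.Adj (v s) (v t) ↔ s <+: t ∨ t <+: s) := by
  obtain ⟨e⟩ : Nonempty (List Bool ≃ ℕ) := nonempty_equiv_of_countable
  obtain ⟨w, hw⟩ := hG.exists_embedding fun m n => e.symm m <+: e.symm n ∨ e.symm n <+: e.symm m
  refine ⟨fun s => w (e s), fun s t hst => ?_⟩
  rcases lt_or_gt_of_ne (e.injective.ne hst) with h | h
  · have := hw _ _ h
    simp only [Equiv.symm_apply_apply] at this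
    exact ⟨this.1.symm, by rw [G.adj_comm, this.2]⟩
  · have := hw _ _ h
    simp only [Equiv.symm_apply_apply] at this
    exact ⟨this.1, by rw [this.2, or_comm]⟩

theorem add_idealGraph {G : SimpleGraph ℕ} (hG : IsRandomGraph G) :
    add (borelPart (millerTrees (idealGraph G))) = ℵ₁ ∧
      add (borelPart (laverTrees (idealGraph G))) = ℵ₁ := by
  obtain ⟨v, hv⟩ := hG.exists_comparability_embedding
  have hne : ∀ (x : ℕ → Bool) m n, m ≠ n → initSeg x m ≠ initSeg x n := fun x m n h h' =>
    h (by simpa using congrArg List.length h')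
  have hadj : ∀ (x : ℕ → Bool) m n, m ≠ n → G.Adj (v (initSeg x m)) (v (initSeg x n)) :=
    fun x m n h => (hv _ _ (hne x m n h)).2.2
      ((le_total m n).imp (initSeg_prefix x) (initSeg_prefix x))
  refine add_borelPart_eq_aleph_one (A := fun x : ℕ → Bool => range fun n => v (initSeg x n))
    (fun d => ?_) aleph_one_le_mk_cantor (fun x => ?_) fun B hB => ?_
  · exact ⟨{{d}}, singleton_subset_iff.2 (Or.inl (by simp)), finite_singleton _, by simp⟩
  · refine ⟨{range fun n => v (initSeg x n)}, singleton_subset_iff.2 (Or.inl ?_),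
      finite_singleton _, by simp⟩
    rintro _ ⟨m, rfl⟩ _ ⟨n, rfl⟩ h
    exact hadj x m n fun h' => h (by simp [h'])
  · obtain ⟨ℱ, h1, h2, h3⟩ := hB
    -- A clique with infinitely many nodes on two branches would contain incomparable nodes, which
    -- are not adjacent; an anticlique contains at most one node of a branch. Finitely many
    -- generators covering a branch must include one with infinitely many of its nodes.
    have hcl : ∀ A ∈ ℱ, {x | {n | v (initSeg x n) ∈ A}.Infinite}.Subsingleton := by
      intro A hA x hx y hy
      by_contra hxy
      obtain ⟨i, hi⟩ := Function.ne_iff.1 hxy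
      obtain ⟨m, hm, him⟩ := hx.exists_gt i
      obtain ⟨m', hm', hmm'⟩ := hx.exists_gt m
      obtain ⟨n, hn, hin⟩ := hy.exists_gt i
      have hcomp : ¬ (initSeg x m <+: initSeg y n ∨ initSeg y n <+: initSeg x m) := by
        have h : initSeg x (i + 1) ≠ initSeg y (i + 1) := fun h =>
          hi (initSeg_eq_iff.1 h i (Nat.lt_succ_self i))
        have hxm := initSeg_prefix x him
        have hyn := initSeg_prefix y hin
        rintro (h' | h')
        · exact h ((List.prefix_of_prefix_length_le (hxm.trans h') hyn (by simp)).eq_of_length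
            (by simp))
        · exact h ((List.prefix_of_prefix_length_le hxm (hyn.trans h') (by simp)).eq_of_length
            (by simp))
      have hnexy : initSeg x m ≠ initSeg y n := fun h => hcomp (Or.inl (h ▸ List.prefix_rfl))
      rcases h1 hA with h | h
      · exact hcomp ((hv _ _ hnexy).2.1 (h hm hn (hv _ _ hnexy).1))
      · exact h hm hm' (hv _ _ (hne x m m' hmm'.ne)).1 (hadj x m m' hmm'.ne)
    refine (h2.countable.biUnion fun A hA => (hcl A hA).finite.countable).mono fun x hx => ?_
    by_contra hno
    simp only [mem_iUnion, mem_ofPred_eq, not_exists, not_infinite] at hno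
    refine Set.infinite_univ (α := ℕ) ((h2.biUnion hno).subset fun n _ => ?_)
    obtain ⟨A, hA, hnA⟩ := h3 (hx (mem_range_self n))
    exact mem_biUnion hA hnA

end TreeIdeals

theorem mainTheorem9 :
    (TreeIdeals.add (TreeIdeals.borelPart (TreeIdeals.millerTrees TreeIdeals.idealED)) = ℵ₁ ∧
      TreeIdeals.add (TreeIdeals.borelPart (TreeIdeals.laverTrees TreeIdeals.idealED)) = ℵ₁) ∧
    (TreeIdeals.add (TreeIdeals.borelPart (TreeIdeals.millerTrees TreeIdeals.idealEDfin)) = ℵ₁ ∧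
      TreeIdeals.add (TreeIdeals.borelPart (TreeIdeals.laverTrees TreeIdeals.idealEDfin)) = ℵ₁) ∧
    (TreeIdeals.add (TreeIdeals.borelPart (TreeIdeals.millerTrees TreeIdeals.idealSolecki)) = ℵ₁ ∧
      TreeIdeals.add (TreeIdeals.borelPart (TreeIdeals.laverTrees TreeIdeals.idealSolecki)) = ℵ₁) ∧
    (TreeIdeals.add (TreeIdeals.borelPart (TreeIdeals.millerTrees TreeIdeals.idealConv)) = ℵ₁ ∧
      TreeIdeals.add (TreeIdeals.borelPart (TreeIdeals.laverTrees TreeIdeals.idealConv)) = ℵ₁) ∧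
    (∀ G : SimpleGraph ℕ, TreeIdeals.IsRandomGraph G →
      TreeIdeals.add (TreeIdeals.borelPart
          (TreeIdeals.millerTrees (TreeIdeals.idealGraph G))) = ℵ₁ ∧
        TreeIdeals.add (TreeIdeals.borelPart
          (TreeIdeals.laverTrees (TreeIdeals.idealGraph G))) = ℵ₁) := by
  exact ⟨TreeIdeals.add_idealED, TreeIdeals.add_idealEDfin, TreeIdeals.add_idealSolecki,
    TreeIdeals.add_idealConv, fun _ hG => TreeIdeals.add_idealGraph hG⟩
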